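/- Let $(\Omega,\mathfrak F,\mathbb P)$ be a probability space, let $0\le l<N$ be integers, let $\xi:\Omega\to\mathbb R^n$ be square integrable, and let $\omega_l,\dots,\omega_{N-1}$ be real random variables. Put $\mathfrak F_{l-1}=\sigma(\xi)$ and $\mathfrak F_k=\sigma(\xi,\omega_l,\dots,\omega_k)$ for $k\ge l$, and assume $\mathbb E[\omega_k\mid\mathfrak F_{k-1}]=0$ and $\mathbb E[\omega_k^2\mid\mathfrak F_{k-1}]=1$ for $l\le k\le N-1$. For a control $u=(u_l,\dots,u_{N-1})$ with values in $\mathbb R^m$ consider the mean-field system $$x_{k+1}=A_kx_k+\bar A_k\mathbb Ex_k+B_ku_k+\bar B_k\mathbb Eu_k+b_k+\big(C_kx_k+\bar C_k\mathbb Ex_k+D_ku_k+\bar D_k\mathbb Eu_k+\sigma_k\big)\omega_k,\qquad x_l=\xi,$$ and the cost $$\begin{aligned}J(l,\xi;u)=\mathbb E\Big\{&\langle Gx_N,x_N\rangle+2\langle g,x_N\rangle+\langle\bar G\,\mathbb Ex_N,\mathbb Ex_N\rangle+2\langle\bar g,\mathbb Ex_N\rangle\\&+\sum_{k=l}^{N-1}\big[\langle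 Q_kx_k,x_k\rangle+2\langle S_kx_k,u_k\rangle+\langle R_ku_k,u_k\rangle+2\langle q_k,x_k\rangle+2\langle\rho_k,u_k\rangle\big]\\&+\sum_{k=l}^{N-1}\big[\langle\bar Q_k\mathbb Ex_k,\mathbb Ex_k\rangle+2\langle\bar S_k\mathbb Ex_k,\mathbb Eu_k\rangle+\langle\bar R_k\mathbb Eu_k,\mathbb Eu_k\rangle+2\langle\bar q_k,\mathbb Ex_k\rangle+2\langle\bar\rho_k,\mathbb Eu_k\rangle\big]\Big\}.\end{aligned}$$ Here all matrices and the vectors $b_k,\sigma_k$ are deterministic, $Q_k,\bar Q_k,R_k,\bar R_k,G,\bar G$ are symmetric, $g,q_k,\rho_k$ are square-integrable random vectors and $\bar g,\bar q_k,\bar\rho_k$ are integrable random vectors. Fix $d\in\{0,1\}$ and let $\mathscr U_{ad}$ be the Hilbert space of all $u=(u_l,\dots,u_{N-1})$ such that $u_k$ is $\mathfrak F_{k-d}$-measurable and $\mathbb E|u_k|^2<\infty$, with inner product $\mathbb E\sum_{k=l}^{N-1}\langle u_k,v_k\rangle$. In the case $d=0$ assume that $J$ is well defined on $\mathscr U_{ad}$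 in the sense that $\omega_kD_ku_k$ is square integrable for all $u\in\mathscr U_{ad}$ and all $k$ (for $d=1$ this is automatic). Let $J^0$ denote the cost of the problem in which $b_k,\sigma_k,g,\bar g,q_k,\bar q_k,\rho_k,\bar\rho_k$ are all replaced by $0$, and assume (A1) $J^0(l,0;u)\ge 0$ for all $u\in\mathscr U_{ad}$. Then for every $\varepsilon>0$ the functional $J^\varepsilon(l,\xi;u)=J(l,\xi;u)+\varepsilon\,\mathbb E\sum_{k=l}^{N-1}|u_k|^2$ has a minimizer $u^\varepsilon$ over $\mathscr U_{ad}$, unique up to null sets, and the following are equivalent: (i) the original problem is open-loop solvable at $(l,\xi)$, that is, there is $u^*\in\mathscr U_{ad}$ with $J(l,\xi;u^*)\le J(l,\xi;u)$ for all $u\in\mathscr U_{ad}$; (ii) there are $\varepsilon_j\downarrow0$ such that $u^{\varepsilon_j}$ converges weakly in $\mathscr U_{ad}$; (iii) there are $\varepsilon_j\downarrow0$ such that $u^{\varepsilon_j}$ converges strongly in $\mathscr U_{ad}$. Moreover, whenever $\varepsilon_j\downarrow0$ and $u^{\varepsilon_j}$ converges weakly or strongly to $u^*$ in $\mathscr U_{ad}$,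 the limit $u^*$ is an open-loop optimal control at $(l,\xi)$, that is, it minimizes $J(l,\xi;\cdot)$ over $\mathscr U_{ad}$. -/

import Mathlib

open MeasureTheory Filter Topology
open scoped RealInnerProductSpace

noncomputable section

namespace MFLQ

/-- The Euclidean space `ℝ^p`. -/
abbrev E (p : ℕ) : Type := EuclideanSpace ℝ (Fin p)

/-- The linear map `x ↦ M x` between Euclidean spaces given by a real matrix `M`. -/
def act {p r : ℕ} (M : Matrix (Fin p) (Fin r) ℝ) (x : E r) : E p :=
  WithLp.toLp 2 (M.mulVec (WithLp.ofLp x))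

/-- The coefficients of a discrete-time mean-field linear-quadratic problem with state space `ℝ^n`
and control space `ℝ^m`. The matrices and `b`, `sig` are deterministic; `g`, `gbar`, `q`, `qbar`,
`rho`, `rhobar` are random. -/
structure Coeff (Ω : Type*) (n m : ℕ) where
  A : ℕ → Matrix (Fin n) (Fin n) ℝ
  Abar : ℕ → Matrix (Fin n) (Fin n) ℝ
  B : ℕ → Matrix (Fin n) (Fin m) ℝ
  Bbar : ℕ → Matrix (Fin n) (Fin m) ℝ
  C : ℕ → Matrix (Fin n) (Fin n) ℝ
  Cbar : ℕ → Matrix (Fin n) (Fin n) ℝ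
  D : ℕ → Matrix (Fin n) (Fin m) ℝ
  Dbar : ℕ → Matrix (Fin n) (Fin m) ℝ
  b : ℕ → E n
  sig : ℕ → E n
  Q : ℕ → Matrix (Fin n) (Fin n) ℝ
  Qbar : ℕ → Matrix (Fin n) (Fin n) ℝ
  S : ℕ → Matrix (Fin m) (Fin n) ℝ
  Sbar : ℕ → Matrix (Fin m) (Fin n) ℝ
  R : ℕ → Matrix (Fin m) (Fin m) ℝ
  Rbar : ℕ → Matrix (Fin m) (Fin m) ℝ
  G : Matrix (Fin n) (Fin n) ℝ
  Gbar : Matrix (Fin n) (Fin n) ℝ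
  g : Ω → E n
  gbar : Ω → E n
  q : ℕ → Ω → E n
  qbar : ℕ → Ω → E n
  rho : ℕ → Ω → E m
  rhobar : ℕ → Ω → E m

/-- The coefficients of the homogeneous problem: all of `b`, `sig`, `g`, `gbar`, `q`, `qbar`,
`rho`, `rhobar` are replaced by zero. -/
def Coeff.homogeneous {Ω : Type*} {n m : ℕ} (P : Coeff Ω n m) : Coeff Ω n m :=
  { P with
    b := 0
    sig := 0
    g := 0
    gbar := 0
    q := 0
    qbar := 0
    rho := 0
    rhobar := 0 }

/-- The standing assumptions on the coefficients over the horizon `{l, …, N - 1}`: the matrices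
that enter quadratically are symmetric, and the random linear weights are such that the linear part
of the cost is finite for square-integrable states and controls. -/
structure Coeff.Regular {Ω : Type*} [MeasurableSpace Ω] {n m : ℕ} (P : Coeff Ω n m)
    (μ : Measure Ω) (l N : ℕ) : Prop where
  Q_symm : ∀ k ∈ Finset.Ico l N, (P.Q k).IsSymm
  Qbar_symm : ∀ k ∈ Finset.Ico l N, (P.Qbar k).IsSymm
  R_symm : ∀ k ∈ Finset.Ico l N, (P.R k).IsSymm
  Rbar_symm : ∀ k ∈ Finset.Ico l N, (P.Rbar k).IsSymm
  G_symm : P.G.IsSymm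
  Gbar_symm : P.Gbar.IsSymm
  g_mem : MemLp P.g 2 μ
  gbar_int : Integrable P.gbar μ
  q_mem : ∀ k ∈ Finset.Ico l N, MemLp (P.q k) 2 μ
  qbar_int : ∀ k ∈ Finset.Ico l N, Integrable (P.qbar k) μ
  rho_mem : ∀ k ∈ Finset.Ico l N, MemLp (P.rho k) 2 μ
  rhobar_int : ∀ k ∈ Finset.Ico l N, Integrable (P.rhobar k) μ

/-- The information generated by `ξ` and the noise with lag `d`: the σ-algebra
`σ(ξ, ω_i : l ≤ i, i + d ≤ k)`. With `𝔉_k = σ(ξ, ω_l, …, ω_k)` (and `𝔉_{l-1} = σ(ξ)`) it is `𝔉_k`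
for `d = 0` and `𝔉_{k-1}` for `d = 1`. -/
abbrev info {Ω : Type*} {n : ℕ} (l : ℕ) (ξ : Ω → E n) (ω : ℕ → Ω → ℝ) (d k : ℕ) :
    MeasurableSpace Ω :=
  MeasurableSpace.comap ξ inferInstance ⊔
    ⨆ (i : ℕ) (_ : l ≤ i ∧ i + d ≤ k), MeasurableSpace.comap (ω i) inferInstance

/-- `ω_l, …, ω_{N-1}` is a martingale difference sequence with unit conditional variance:
`E[ω_k | 𝔉_{k-1}] = 0` and `E[ω_k² | 𝔉_{k-1}] = 1`, where `𝔉_{l-1} = σ(ξ)`. -/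
structure IsNoise {Ω : Type*} [MeasurableSpace Ω] {n : ℕ} (μ : Measure Ω) (l N : ℕ)
    (ξ : Ω → E n) (ω : ℕ → Ω → ℝ) : Prop where
  meas : ∀ k ∈ Finset.Ico l N, Measurable (ω k)
  mean : ∀ k ∈ Finset.Ico l N, μ[ω k | info l ξ ω 1 k] =ᵐ[μ] 0
  var : ∀ k ∈ Finset.Ico l N, μ[fun s => ω k s ^ 2 | info l ξ ω 1 k] =ᵐ[μ] 1

/-- The state process `x` started from `x_l = x0` under the control `u`. It is set equal to `x0`
also at the times before `l`, which play no role. -/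
def state {Ω : Type*} [MeasurableSpace Ω] {n m : ℕ} (P : Coeff Ω n m) (μ : Measure Ω)
    (ω : ℕ → Ω → ℝ) (l : ℕ) (x0 : Ω → E n) (u : ℕ → Ω → E m) : ℕ → Ω → E n
  | 0 => x0
  | k + 1 =>
    if k < l then x0
    else fun s =>
      act (P.A k) (state P μ ω l x0 u k s) + act (P.Abar k) (∫ t, state P μ ω l x0 u k t ∂μ)
        + act (P.B k) (u k s) + act (P.Bbar k) (∫ t, u k t ∂μ) + P.b k
        + ω k s • (act (P.C k) (state P μ ω l x0 u k s)
            + act (P.Cbar k) (∫ t, state P μ ω l x0 u k t ∂μ)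
            + act (P.D k) (u k s) + act (P.Dbar k) (∫ t, u k t ∂μ) + P.sig k)

/-- The cost functional `J(l, x0; u)`. -/
def cost {Ω : Type*} [MeasurableSpace Ω] {n m : ℕ} (P : Coeff Ω n m) (μ : Measure Ω)
    (ω : ℕ → Ω → ℝ) (l N : ℕ) (x0 : Ω → E n) (u : ℕ → Ω → E m) : ℝ :=
  let x := state P μ ω l x0 u
  let Ex : ℕ → E n := fun k => ∫ t, x k t ∂μ
  let Eu : ℕ → E m := fun k => ∫ t, u k t ∂μ
  ∫ s, (⟪act P.G (x N s), x N s⟫ + 2 * ⟪P.g s, x N s⟫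
      + ⟪act P.Gbar (Ex N), Ex N⟫ + 2 * ⟪P.gbar s, Ex N⟫
      + ∑ k ∈ Finset.Ico l N,
          (⟪act (P.Q k) (x k s), x k s⟫ + 2 * ⟪act (P.S k) (x k s), u k s⟫
            + ⟪act (P.R k) (u k s), u k s⟫
            + 2 * (⟪P.q k s, x k s⟫ + ⟪P.rho k s, u k s⟫))
      + ∑ k ∈ Finset.Ico l N,
          (⟪act (P.Qbar k) (Ex k), Ex k⟫ + 2 * ⟪act (P.Sbar k) (Ex k), Eu k⟫
            + ⟪act (P.Rbar k) (Eu k), Eu k⟫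
            + 2 * (⟪P.qbar k s, Ex k⟫ + ⟪P.rhobar k s, Eu k⟫))) ∂μ

/-- The inner product `E ∑_{k=l}^{N-1} ⟨u_k, v_k⟩` of control processes. -/
def ctrlInner {Ω : Type*} [MeasurableSpace Ω] {m : ℕ} (μ : Measure Ω) (l N : ℕ)
    (u v : ℕ → Ω → E m) : ℝ :=
  ∫ s, ∑ k ∈ Finset.Ico l N, ⟪u k s, v k s⟫ ∂μ

/-- The squared norm `E ∑_{k=l}^{N-1} |u_k|²` of a control process. -/
def ctrlSq {Ω : Type*} [MeasurableSpace Ω] {m : ℕ} (μ : Measure Ω) (l N : ℕ)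
    (u : ℕ → Ω → E m) : ℝ :=
  ∫ s, ∑ k ∈ Finset.Ico l N, ‖u k s‖ ^ 2 ∂μ

/-- The cost functional of the `ε`-regularized problem:
`J^ε(l, x0; u) = J(l, x0; u) + ε E ∑_{k=l}^{N-1} |u_k|²`. -/
def regCost {Ω : Type*} [MeasurableSpace Ω] {n m : ℕ} (P : Coeff Ω n m) (μ : Measure Ω)
    (ω : ℕ → Ω → ℝ) (l N : ℕ) (x0 : Ω → E n) (ε : ℝ) (u : ℕ → Ω → E m) : ℝ :=
  cost P μ ω l N x0 u + ε * ctrlSq μ l N u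

/-- The admissible controls for the information flow `ℱ`: each `u_k` (`l ≤ k < N`) is
`ℱ_k`-measurable and square integrable. The values of `u` at other times play no role. -/
def Admissible {Ω : Type*} [MeasurableSpace Ω] {m : ℕ} (μ : Measure Ω) (l N : ℕ)
    (ℱ : ℕ → MeasurableSpace Ω) (u : ℕ → Ω → E m) : Prop :=
  ∀ k ∈ Finset.Ico l N, Measurable[ℱ k] (u k) ∧ MemLp (u k) 2 μ

/-- `u` minimizes the functional `Jfun` over the admissible controls. -/
def IsOptimal {Ω : Type*} [MeasurableSpace Ω] {m : ℕ} (μ : Measure Ω) (l N : ℕ)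
    (ℱ : ℕ → MeasurableSpace Ω) (Jfun : (ℕ → Ω → E m) → ℝ) (u : ℕ → Ω → E m) : Prop :=
  Admissible μ l N ℱ u ∧ ∀ v, Admissible μ l N ℱ v → Jfun u ≤ Jfun v

/-- Weak convergence in the Hilbert space of admissible controls. -/
def WeakLim {Ω : Type*} [MeasurableSpace Ω] {m : ℕ} (μ : Measure Ω) (l N : ℕ)
    (ℱ : ℕ → MeasurableSpace Ω) (w : ℕ → ℕ → Ω → E m) (u : ℕ → Ω → E m) : Prop :=
  Admissible μ l N ℱ u ∧ ∀ v, Admissible μ l N ℱ v →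
    Tendsto (fun j => ctrlInner μ l N (w j) v) atTop (𝓝 (ctrlInner μ l N u v))

/-- Strong (norm) convergence in the Hilbert space of admissible controls. -/
def StrongLim {Ω : Type*} [MeasurableSpace Ω] {m : ℕ} (μ : Measure Ω) (l N : ℕ)
    (ℱ : ℕ → MeasurableSpace Ω) (w : ℕ → ℕ → Ω → E m) (u : ℕ → Ω → E m) : Prop :=
  Admissible μ l N ℱ u ∧ Tendsto (fun j => ctrlSq μ l N (w j - u)) atTop (𝓝 0)

/-- A sequence of positive regularization parameters decreasing to zero. -/
def IsVanishing (e : ℕ → ℝ) : Prop :=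
  StrictAnti e ∧ (∀ j, 0 < e j) ∧ Tendsto e atTop (𝓝 0)

end MFLQ

end

noncomputable section

namespace MFLQ

/-! Modulo null sets the admissible controls form a Hilbert space (`CtrlSpace`), on which the cost
is a continuous quadratic functional `B u u + L u + r` whose quadratic part is the homogeneous cost
started from zero (`cost_quadratic`). So (A1) says exactly that `B` is nonnegative, that is, that
the cost is convex, and the rest is Tikhonov regularization.

Adding `ε‖u‖²` makes the form coercive: Lax–Milgram gives a minimizer and quadratic growth its
uniqueness. If the unregularized problem has a minimizer, comparing the regularized minimizers at
two parameters shows that their norms are nondecreasing as `ε` decreases, are bounded, and control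
their mutual distances, so they converge strongly (`tikhonov_converges`). Conversely, the Euler
equation is affine in the control, hence survives weak limits as `ε → 0`, and convexity makes it
sufficient (`minimizer_of_tikhonov_weak_limit`).

The probabilistic work is the continuity of the state in the control. Matrices and expectations act
boundedly; only multiplication by the possibly unbounded noise is delicate. The products lie in `L²`
by the unit conditional variance, or by hypothesis for the control term at lag zero, and the closed
graph theorem turns this into boundedness (`exists_clm_smul`). -/

/-- The inner product of a real inner product space as a bounded bilinear map. -/
def innerBilin (H : Type*) [NormedAddCommGroup H] [InnerProductSpace ℝ H] :
    H →L[ℝ] H →L[ℝ] ℝ :=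
  (isBoundedBilinearMap_inner (𝕜 := ℝ) (E := H)).toContinuousLinearMap

@[simp]
theorem innerBilin_apply {H : Type*} [NormedAddCommGroup H] [InnerProductSpace ℝ H] (u v : H) :
    innerBilin H u v = ⟪u, v⟫ := rfl

/-! ### Tikhonov regularization of convex quadratic functionals on a Hilbert space. -/

section Tikhonov

variable {H : Type*} [NormedAddCommGroup H] [InnerProductSpace ℝ H]
  {B : H →L[ℝ] H →L[ℝ] ℝ} {L : H →L[ℝ] ℝ} {c : ℝ} {J : H → ℝ}

/-- The Tikhonov regularization of a functional on a Hilbert space. -/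
def tikhonov (J : H → ℝ) (ε : ℝ) (u : H) : ℝ := J u + ε * ‖u‖ ^ 2

theorem tikhonov_zero {H : Type*} [NormedAddCommGroup H] (J : H → ℝ) : tikhonov J 0 = J := by
  funext u; simp [tikhonov]

/-- A nonzero slope at `t = 0` would make the quadratic negative nearby. The test point has
denominator `a + 1` instead of `2 * a` so that `a = 0` is covered too. -/
theorem eq_zero_of_forall_quadratic_nonneg {a d : ℝ} (ha : 0 ≤ a)
    (h : ∀ t : ℝ, 0 ≤ t * d + t ^ 2 * a) : d = 0 := by
  have h1 := h (-d / (a + 1))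
  have h2 : -d / (a + 1) * d + (-d / (a + 1)) ^ 2 * a = -(d / (a + 1)) ^ 2 := by
    field_simp; ring
  have h3 : d / (a + 1) = 0 := by
    rw [h2] at h1
    exact pow_eq_zero_iff two_ne_zero |>.1 (le_antisymm (by linarith) (sq_nonneg _))
  have h4 : a + 1 ≠ 0 := by positivity
  simpa [h4] using h3

/-- The exact second-order expansion. `B` is not assumed symmetric, so both cross terms appear in
the derivative. -/
theorem tikhonov_add (hJ : ∀ u, J u = B u u + L u + c) (ε : ℝ) (u w : H) :
    tikhonov J ε (u + w) = tikhonov J ε u + (B u w + B w u + L w + 2 * ε * ⟪u, w⟫)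
      + (B w w + ε * ‖w‖ ^ 2) := by
  simp only [tikhonov, hJ, map_add, add_apply, norm_add_sq_real]
  ring

/-- The Euler equation characterizes the minimizers of a convex quadratic functional. -/
theorem tikhonov_minimizer_iff (hJ : ∀ u, J u = B u u + L u + c) (hB : ∀ u, 0 ≤ B u u)
    {ε : ℝ} (hε : 0 ≤ ε) (u : H) :
    (∀ v, tikhonov J ε u ≤ tikhonov J ε v) ↔
      ∀ w, B u w + B w u + L w + 2 * ε * ⟪u, w⟫ = 0 := by
  constructor
  · intro h w
    refine eq_zero_of_forall_quadratic_nonneg (a := B w w + ε * ‖w‖ ^ 2)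
      (add_nonneg (hB w) (by positivity)) fun t => ?_
    have h1 := h (u + t • w)
    rw [tikhonov_add hJ] at h1
    simp only [map_smul, smul_apply, smul_eq_mul, inner_smul_right, norm_smul,
      mul_pow, Real.norm_eq_abs, sq_abs] at h1
    linarith
  · intro h v
    have h1 := tikhonov_add hJ ε u (v - u)
    rw [h, add_sub_cancel] at h1
    have h2 := hB (v - u)
    have h3 : 0 ≤ ε * ‖v - u‖ ^ 2 := by positivity
    linarith

/-- Quadratic growth of the regularized functional at its minimizer. -/
theorem tikhonov_growth (hJ : ∀ u, J u = B u u + L u + c) (hB : ∀ u, 0 ≤ B u u)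
    {ε : ℝ} (hε : 0 ≤ ε) {u : H} (hu : ∀ v, tikhonov J ε u ≤ tikhonov J ε v) (v : H) :
    tikhonov J ε u + ε * ‖v - u‖ ^ 2 ≤ tikhonov J ε v := by
  have h1 := tikhonov_add hJ ε u (v - u)
  rw [(tikhonov_minimizer_iff hJ hB hε u).1 hu, add_sub_cancel] at h1
  have h2 := hB (v - u)
  linarith

theorem tikhonov_minimizer_unique (hJ : ∀ u, J u = B u u + L u + c) (hB : ∀ u, 0 ≤ B u u)
    {ε : ℝ} (hε : 0 < ε) {u v : H} (hu : ∀ w, tikhonov J ε u ≤ tikhonov J ε w)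
    (hv : ∀ w, tikhonov J ε v ≤ tikhonov J ε w) : v = u := by
  have h1 := tikhonov_growth hJ hB hε.le hu v
  have h2 := hv u
  have h3 : ε * ‖v - u‖ ^ 2 ≤ 0 := by linarith
  have h4 : ‖v - u‖ ^ 2 ≤ 0 := by nlinarith
  have h5 : ‖v - u‖ = 0 := pow_eq_zero_iff two_ne_zero |>.1 (le_antisymm h4 (sq_nonneg _))
  exact sub_eq_zero.1 (norm_eq_zero.1 h5)

/-- The Euler equation is a linear equation for the symmetrized form `B + B.flip + 2ε⟪·,·⟫`, which
is coercive with constant `2 * ε`; Lax–Milgram solves it with right-hand side `-L`. -/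
theorem exists_tikhonov_minimizer [CompleteSpace H] (hJ : ∀ u, J u = B u u + L u + c)
    (hB : ∀ u, 0 ≤ B u u) {ε : ℝ} (hε : 0 < ε) :
    ∃ u, ∀ v, tikhonov J ε u ≤ tikhonov J ε v := by
  have hc : IsCoercive (B + B.flip + (2 * ε) • innerBilin H) := by
    refine ⟨2 * ε, by positivity, fun u => ?_⟩
    have h1 := hB u
    have h2 : (B + B.flip + (2 * ε) • innerBilin H) u u
        = B u u + B u u + 2 * ε * (‖u‖ * ‖u‖) := by
      rw [← real_inner_self_eq_norm_mul_norm u]; rfl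
    rw [h2]
    linarith
  refine ⟨hc.continuousLinearEquivOfBilin.symm (-(InnerProductSpace.toDual ℝ H).symm L),
    (tikhonov_minimizer_iff hJ hB hε.le _).2 fun w => ?_⟩
  set u := hc.continuousLinearEquivOfBilin.symm (-(InnerProductSpace.toDual ℝ H).symm L)
  have h1 := hc.continuousLinearEquivOfBilin_apply u w
  rw [ContinuousLinearEquiv.apply_symm_apply, inner_neg_left,
    InnerProductSpace.toDual_symm_apply] at h1
  have h2 : (B + B.flip + (2 * ε) • innerBilin H) u w
        = B u w + B w u + 2 * ε * ⟪u, w⟫ := rfl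
  linarith

/-- If the unregularized functional has a minimizer, then the regularized minimizers converge
strongly along every sequence of parameters decreasing to zero. -/
theorem tikhonov_converges [CompleteSpace H] (hJ : ∀ u, J u = B u u + L u + c)
    (hB : ∀ u, 0 ≤ B u u) {e : ℕ → ℝ} (he : IsVanishing e) {w : ℕ → H}
    (hw : ∀ j v, tikhonov J (e j) (w j) ≤ tikhonov J (e j) v) {us : H} (hus : ∀ v, J us ≤ J v) :
    ∃ u, Tendsto w atTop (𝓝 u) := by
  obtain ⟨hanti, hpos, -⟩ := he
  have hsq : ∀ i j, i ≤ j → ‖w j - w i‖ ^ 2 ≤ ‖w j‖ ^ 2 - ‖w i‖ ^ 2 := by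
    intro i j hij
    rcases hij.eq_or_lt with rfl | hij
    · simp
    have h1 := tikhonov_growth hJ hB (hpos i).le (hw i) (w j)
    have h2 := tikhonov_growth hJ hB (hpos j).le (hw j) (w i)
    have h3 := hanti hij
    rw [norm_sub_rev] at h2
    simp only [tikhonov] at h1 h2
    have h4 : 0 ≤ e j * ‖w j - w i‖ ^ 2 := mul_nonneg (hpos j).le (sq_nonneg _)
    -- Adding the two growth inequalities cancels the values of `J` and leaves the factor `e i + e
    -- j` on the left, which may be lowered to `e i - e j`.
    have h5 : (e i - e j) * ‖w j - w i‖ ^ 2 ≤ (e i - e j) * (‖w j‖ ^ 2 - ‖w i‖ ^ 2) := by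
      nlinarith
    exact le_of_mul_le_mul_left h5 (sub_pos.2 h3)
  have hmono : Monotone fun j => ‖w j‖ ^ 2 := fun i j hij => by
    have := hsq i j hij
    have := sq_nonneg ‖w j - w i‖
    show ‖w i‖ ^ 2 ≤ ‖w j‖ ^ 2
    linarith
  have hbdd : BddAbove (Set.range fun j => ‖w j‖ ^ 2) := by
    refine ⟨‖us‖ ^ 2, ?_⟩
    rintro _ ⟨j, rfl⟩
    have h1 := hw j us
    have h2 := hus (w j)
    simp only [tikhonov] at h1
    exact le_of_mul_le_mul_left (by linarith) (hpos j)
  have hcau : CauchySeq fun j => ‖w j‖ ^ 2 :=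
    (tendsto_atTop_ciSup hmono hbdd).cauchySeq
  refine cauchySeq_tendsto_of_complete (Metric.cauchySeq_iff'.2 fun δ hδ => ?_)
  obtain ⟨M, hM⟩ := Metric.cauchySeq_iff'.1 hcau (δ ^ 2) (by positivity)
  refine ⟨M, fun j hj => ?_⟩
  have h1 := hM j hj
  rw [Real.dist_eq] at h1
  have h2 := (hsq M j hj).trans_lt ((le_abs_self _).trans_lt h1)
  rw [dist_eq_norm]
  exact lt_of_pow_lt_pow_left₀ 2 hδ.le h2

/-- A weak limit of regularized minimizers minimizes the unregularized functional. -/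
theorem minimizer_of_tikhonov_weak_limit [CompleteSpace H] (hJ : ∀ u, J u = B u u + L u + c)
    (hB : ∀ u, 0 ≤ B u u) {e : ℕ → ℝ} (he : IsVanishing e) {w : ℕ → H}
    (hw : ∀ j v, tikhonov J (e j) (w j) ≤ tikhonov J (e j) v) {us : H}
    (hus : ∀ v, Tendsto (fun j => ⟪w j, v⟫) atTop (𝓝 ⟪us, v⟫)) (v : H) : J us ≤ J v := by
  have key : ∀ v, tikhonov J 0 us ≤ tikhonov J 0 v := by
    refine (tikhonov_minimizer_iff hJ hB le_rfl us).2 fun z => ?_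
    -- By Riesz representation, weak convergence is convergence under every bounded functional, in
    -- particular under both partial maps of `B` at `z`.
    have hlim : ∀ f : H →L[ℝ] ℝ, Tendsto (fun j => f (w j)) atTop (𝓝 (f us)) := fun f => by
      have h1 : ∀ x, f x = ⟪x, (InnerProductSpace.toDual ℝ H).symm f⟫ := fun x => by
        rw [real_inner_comm, InnerProductSpace.toDual_symm_apply]
      simp only [h1]
      exact hus _
    have h1 := (((hlim (B.flip z)).add (hlim (B z))).add
      (tendsto_const_nhds (x := L z))).add ((he.2.2.const_mul 2).mul (hus z))
    have h2 : ∀ j, B.flip z (w j) + B z (w j) + L z + 2 * e j * ⟪w j, z⟫ = 0 := fun j =>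
      (tikhonov_minimizer_iff hJ hB (he.2.1 j).le (w j)).1 (hw j) z
    simp only [h2] at h1
    have h3 := tendsto_nhds_unique h1 tendsto_const_nhds
    simpa using h3
  simpa only [tikhonov_zero] using key v

end Tikhonov

/-! ### Random vectors affine, and integrals quadratic, in a Hilbert space parameter. -/

section Families

variable {Ω : Type*} [MeasurableSpace Ω] {μ : Measure Ω}
  {H : Type*} [NormedAddCommGroup H] [InnerProductSpace ℝ H]
  {α : Type*} {c : α → H}
  {F : Type*} [NormedAddCommGroup F] [InnerProductSpace ℝ F]
  {F' : Type*} [NormedAddCommGroup F'] [InnerProductSpace ℝ F']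

/-- The square-integrable random vectors `x a` depend, up to null sets, on `c a` in a continuous
affine way, and `x₀ a` is the linear part. -/
def AffineFamily (μ : Measure Ω) (c : α → H) (x x₀ : α → Ω → F) : Prop :=
  ∃ (T : H →L[ℝ] Lp F 2 μ) (t : Lp F 2 μ), ∀ a,
    x a =ᵐ[μ] (T (c a) + t : Lp F 2 μ) ∧ x₀ a =ᵐ[μ] T (c a)

/-- The integrals of `f a` are a continuous quadratic function of `c a`, whose purely quadratic
part is given by the integrals of `f₀ a`. -/
def QuadraticFamily (μ : Measure Ω) (c : α → H) (f f₀ : α → Ω → ℝ) : Prop :=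
  (∀ a, Integrable (f a) μ ∧ Integrable (f₀ a) μ) ∧
  ∃ (B : H →L[ℝ] H →L[ℝ] ℝ) (L : H →L[ℝ] ℝ) (r : ℝ), ∀ a,
    ∫ s, f a s ∂μ = B (c a) (c a) + L (c a) + r ∧ ∫ s, f₀ a s ∂μ = B (c a) (c a)

namespace AffineFamily

variable {x x₀ y y₀ : α → Ω → F}

theorem memLp (h : AffineFamily μ c x x₀) (a : α) : MemLp (x a) 2 μ := by
  obtain ⟨T, t, h⟩ := h
  exact (memLp_congr_ae (h a).1).2 (Lp.memLp _)

theorem memLp_linear (h : AffineFamily μ c x x₀) (a : α) : MemLp (x₀ a) 2 μ := by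
  obtain ⟨T, t, h⟩ := h
  exact (memLp_congr_ae (h a).2).2 (Lp.memLp _)

theorem of_linear {T : H →L[ℝ] Lp F 2 μ} (h : ∀ a, x a =ᵐ[μ] T (c a)) :
    AffineFamily μ c x x :=
  ⟨T, 0, fun a => ⟨by simpa using h a, h a⟩⟩

theorem const {f : Ω → F} (hf : MemLp f 2 μ) : AffineFamily μ c (fun _ => f) (fun _ => 0) := by
  refine ⟨0, hf.toLp f, fun a => ⟨?_, ?_⟩⟩
  · simpa using hf.coeFn_toLp.symm
  · simpa using (Lp.coeFn_zero F 2 μ).symm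

theorem add (hx : AffineFamily μ c x x₀) (hy : AffineFamily μ c y y₀) :
    AffineFamily μ c (fun a s => x a s + y a s) (fun a s => x₀ a s + y₀ a s) := by
  obtain ⟨T, t, hx⟩ := hx
  obtain ⟨T', t', hy⟩ := hy
  refine ⟨T + T', t + t', fun a => ⟨?_, ?_⟩⟩
  · have h1 : (T + T') (c a) + (t + t') = (T (c a) + t) + (T' (c a) + t') := by
      rw [add_apply]; abel
    rw [h1]
    filter_upwards [(hx a).1, (hy a).1, Lp.coeFn_add (T (c a) + t) (T' (c a) + t')]
      with s h1 h2 h3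
    rw [h1, h2, h3, Pi.add_apply]
  · rw [add_apply]
    filter_upwards [(hx a).2, (hy a).2, Lp.coeFn_add (T (c a)) (T' (c a))] with s h1 h2 h3
    rw [h1, h2, h3, Pi.add_apply]

theorem clm (hx : AffineFamily μ c x x₀) (M : F →L[ℝ] F') :
    AffineFamily μ c (fun a s => M (x a s)) (fun a s => M (x₀ a s)) := by
  obtain ⟨T, t, hx⟩ := hx
  refine ⟨(M.compLpL 2 μ).comp T, M.compLpL 2 μ t, fun a => ⟨?_, ?_⟩⟩
  · rw [ContinuousLinearMap.comp_apply, ← map_add]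
    filter_upwards [(hx a).1, M.coeFn_compLpL (p := 2) (T (c a) + t)] with s h1 h2
    rw [h1, h2]
  · rw [ContinuousLinearMap.comp_apply]
    filter_upwards [(hx a).2, M.coeFn_compLpL (p := 2) (T (c a))] with s h1 h2
    rw [h1, h2]

variable [CompleteSpace F]

variable (μ F) in
/-- The expectation as a bounded linear map on square-integrable random vectors. -/
def expectL [IsProbabilityMeasure μ] : Lp F 2 μ →L[ℝ] F :=
  ContinuousLinearMap.adjoint (Lp.constL 2 μ ℝ (E := F))

/-- Pairing with a constant `v` in `L²` is pairing the mean with `v`, so the adjoint of the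
inclusion of constants is the expectation. -/
theorem expectL_apply [IsProbabilityMeasure μ] (f : Lp F 2 μ) : expectL μ F f = ∫ s, f s ∂μ := by
  refine ext_inner_left ℝ fun v => ?_
  rw [expectL, ContinuousLinearMap.adjoint_inner_right, L2.inner_def,
    ← integral_inner ((Lp.memLp f).integrable one_le_two)]
  refine integral_congr_ae ?_
  filter_upwards [Lp.coeFn_const 2 μ v] with s hs
  change ⟪(Lp.const 2 μ v : Lp F 2 μ) s, f s⟫ = _
  rw [hs, Function.const_apply]

theorem expect [IsProbabilityMeasure μ] (hx : AffineFamily μ c x x₀) :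
    AffineFamily μ c (fun a _ => ∫ s, x a s ∂μ) (fun a _ => ∫ s, x₀ a s ∂μ) := by
  obtain ⟨T, t, hx⟩ := hx
  refine ⟨((Lp.constL 2 μ ℝ).comp (expectL μ F)).comp T, Lp.constL 2 μ ℝ (expectL μ F t),
    fun a => ⟨?_, ?_⟩⟩
  · rw [ContinuousLinearMap.comp_apply, ContinuousLinearMap.comp_apply, ← map_add, ← map_add,
      expectL_apply, ← integral_congr_ae (hx a).1]
    exact (Lp.coeFn_const 2 μ _).symm
  · rw [ContinuousLinearMap.comp_apply, ContinuousLinearMap.comp_apply,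
      expectL_apply, ← integral_congr_ae (hx a).2]
    exact (Lp.coeFn_const 2 μ _).symm

omit [CompleteSpace F] in
/-- Multiplication by a random variable is a closed operator: if it maps the range of a bounded
linear map into `L²`, then the composition is bounded. -/
theorem exists_clm_smul [CompleteSpace H] [CompleteSpace F] (w : Ω → ℝ) (T : H →L[ℝ] Lp F 2 μ)
    (hT : ∀ h, MemLp (fun s => w s • T h s) 2 μ) :
    ∃ W : H →L[ℝ] Lp F 2 μ, ∀ h, W h =ᵐ[μ] fun s => w s • T h s := by
  let W : H →ₗ[ℝ] Lp F 2 μ :=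
    { toFun := fun h => (hT h).toLp _
      map_add' := fun h k => by
        rw [← MemLp.toLp_add]
        refine MemLp.toLp_congr _ _ ?_
        rw [map_add]
        filter_upwards [Lp.coeFn_add (T h) (T k)] with s hs
        rw [hs, Pi.add_apply, Pi.add_apply, smul_add]
      map_smul' := fun r h => by
        rw [RingHom.id_apply, ← MemLp.toLp_const_smul]
        refine MemLp.toLp_congr _ _ ?_
        rw [map_smul]
        filter_upwards [Lp.coeFn_smul r (T h)] with s hs
        rw [hs, Pi.smul_apply, Pi.smul_apply, smul_comm] }
  have hW : ∀ h, W h =ᵐ[μ] fun s => w s • T h s := fun h => (hT h).coeFn_toLp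
  refine ⟨ContinuousLinearMap.ofSeqClosedGraph (g := W) ?_, hW⟩
  intro u h y hu hy
  have h1 : Tendsto (fun j => T (u j)) atTop (𝓝 (T h)) := (T.continuous.tendsto h).comp hu
  obtain ⟨ns, hns, hae⟩ := (tendstoInMeasure_of_tendsto_Lp h1).exists_seq_tendsto_ae
  -- A second extraction along the first subsequence makes both convergences hold almost everywhere,
  -- where multiplication by `w s` is continuous.
  obtain ⟨ms, hms, hae'⟩ :=
    (tendstoInMeasure_of_tendsto_Lp (hy.comp hns.tendsto_atTop)).exists_seq_tendsto_ae
  refine Lp.ext ?_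
  have h2 : ∀ᵐ s ∂μ, ∀ j, W (u j) s = w s • T (u j) s := ae_all_iff.2 fun j => hW (u j)
  filter_upwards [hae, hae', hW h, h2] with s h3 h4 h5 h6
  rw [h5]
  refine tendsto_nhds_unique h4 ?_
  simp only [Function.comp_apply, h6]
  exact (h3.comp hms.tendsto_atTop).const_smul (w s)

omit [CompleteSpace F] in
theorem smul_of_memLp [CompleteSpace H] [CompleteSpace F] (hx : AffineFamily μ c x x₀)
    (hc : Function.Surjective c) (w : Ω → ℝ)
    (h : ∀ a, MemLp (fun s => w s • x a s) 2 μ) (h₀ : ∀ a, MemLp (fun s => w s • x₀ a s) 2 μ) :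
    AffineFamily μ c (fun a s => w s • x a s) (fun a s => w s • x₀ a s) := by
  obtain ⟨T, t, hx⟩ := hx
  have hT : ∀ h, MemLp (fun s => w s • T h s) 2 μ := fun h => by
    obtain ⟨a, rfl⟩ := hc h
    refine (memLp_congr_ae ?_).1 (h₀ a)
    filter_upwards [(hx a).2] with s hs
    rw [hs]
  obtain ⟨W, hW⟩ := exists_clm_smul w T hT
  -- At a parameter of class zero the family reduces to its constant part, which isolates `t`.
  obtain ⟨a₀, ha₀⟩ := hc 0
  have ht : MemLp (fun s => w s • t s) 2 μ := by
    refine (memLp_congr_ae ?_).1 (h a₀)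
    have h1 := (hx a₀).1
    rw [ha₀, map_zero, zero_add] at h1
    filter_upwards [h1] with s hs
    rw [hs]
  refine ⟨W, ht.toLp _, fun a => ⟨?_, ?_⟩⟩
  · filter_upwards [(hx a).1, hW (c a), Lp.coeFn_add (T (c a)) t, ht.coeFn_toLp,
      Lp.coeFn_add (W (c a)) (ht.toLp _)] with s h1 h2 h3 h4 h5
    rw [h1, h3, h5, Pi.add_apply, Pi.add_apply, h2, h4, smul_add]
  · filter_upwards [(hx a).2, hW (c a)] with s h1 h2
    rw [h1, h2]

omit [CompleteSpace F] in
theorem inner (hx : AffineFamily μ c x x₀) (hy : AffineFamily μ c y y₀) :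
    QuadraticFamily μ c (fun a s => ⟪x a s, y a s⟫) (fun a s => ⟪x₀ a s, y₀ a s⟫) := by
  obtain ⟨T, t, hx⟩ := hx
  obtain ⟨T', t', hy⟩ := hy
  have e1 : ∀ a, (fun s => ⟪x a s, y a s⟫) =ᵐ[μ]
      fun s => ⟪(T (c a) + t : Lp F 2 μ) s, (T' (c a) + t' : Lp F 2 μ) s⟫ := fun a => by
    filter_upwards [(hx a).1, (hy a).1] with s h1 h2
    rw [h1, h2]
  have e2 : ∀ a, (fun s => ⟪x₀ a s, y₀ a s⟫) =ᵐ[μ] fun s => ⟪T (c a) s, T' (c a) s⟫ := fun a => by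
    filter_upwards [(hx a).2, (hy a).2] with s h1 h2
    rw [h1, h2]
  refine ⟨fun a => ⟨(integrable_congr (e1 a)).2 (L2.integrable_inner _ _),
    (integrable_congr (e2 a)).2 (L2.integrable_inner _ _)⟩,
    (innerBilin (Lp F 2 μ)).bilinearComp T T',
    (innerBilin (Lp F 2 μ) t).comp T' + ((innerBilin (Lp F 2 μ)).flip t').comp T, ⟪t, t'⟫,
    fun a => ⟨?_, ?_⟩⟩
  · rw [integral_congr_ae (e1 a), ← L2.inner_def]
    simp only [inner_add_left, inner_add_right, ContinuousLinearMap.bilinearComp_apply,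
      add_apply, ContinuousLinearMap.comp_apply, innerBilin_apply, ContinuousLinearMap.flip_apply]
    ring
  · rw [integral_congr_ae (e2 a), ← L2.inner_def]
    rfl

/-- The pairing of an integrable random vector with the expectation of an affine family. -/
theorem inner_expect [IsProbabilityMeasure μ] (hx : AffineFamily μ c x x₀) {f : Ω → F}
    (hf : Integrable f μ) :
    QuadraticFamily μ c (fun a s => ⟪f s, ∫ t, x a t ∂μ⟫)
      (fun a s => ⟪(0 : Ω → F) s, ∫ t, x₀ a t ∂μ⟫) := by
  obtain ⟨T, t, hx⟩ := hx
  refine ⟨fun a => ⟨hf.inner_const _, by simp⟩, 0,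
    ((innerBilin F (∫ s, f s ∂μ)).comp (expectL μ F)).comp T,
    ⟪∫ s, f s ∂μ, expectL μ F t⟫, fun a => ⟨?_, by simp⟩⟩
  -- The expectation is deterministic, so `f` enters only through its mean and need not be square
  -- integrable.
  have h1 : ∫ s, ⟪f s, ∫ t, x a t ∂μ⟫ ∂μ = ⟪∫ s, f s ∂μ, ∫ t, x a t ∂μ⟫ := by
    simp only [real_inner_comm (∫ t, x a t ∂μ)]
    exact integral_inner hf _
  rw [h1, integral_congr_ae (hx a).1, ← expectL_apply, map_add, inner_add_right]
  simp

end AffineFamily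

namespace QuadraticFamily

variable {f f₀ g g₀ : α → Ω → ℝ}

theorem add (hf : QuadraticFamily μ c f f₀) (hg : QuadraticFamily μ c g g₀) :
    QuadraticFamily μ c (fun a s => f a s + g a s) (fun a s => f₀ a s + g₀ a s) := by
  obtain ⟨hfi, B, L, r, hf⟩ := hf
  obtain ⟨hgi, B', L', r', hg⟩ := hg
  refine ⟨fun a => ⟨(hfi a).1.add (hgi a).1, (hfi a).2.add (hgi a).2⟩, B + B', L + L', r + r',
    fun a => ⟨?_, ?_⟩⟩
  · rw [integral_add (hfi a).1 (hgi a).1, (hf a).1, (hg a).1]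
    simp only [add_apply]
    ring
  · rw [integral_add (hfi a).2 (hgi a).2, (hf a).2, (hg a).2]
    simp only [add_apply]

theorem const_mul (hf : QuadraticFamily μ c f f₀) (k : ℝ) :
    QuadraticFamily μ c (fun a s => k * f a s) (fun a s => k * f₀ a s) := by
  obtain ⟨hfi, B, L, r, hf⟩ := hf
  refine ⟨fun a => ⟨(hfi a).1.const_mul k, (hfi a).2.const_mul k⟩, k • B, k • L, k * r,
    fun a => ⟨?_, ?_⟩⟩
  · rw [integral_const_mul, (hf a).1]
    simp only [smul_apply, smul_eq_mul]
    ring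
  · rw [integral_const_mul, (hf a).2]
    simp only [smul_apply, smul_eq_mul]

theorem sum {ι : Type*} {I : Finset ι} {f f₀ : ι → α → Ω → ℝ}
    (h : ∀ i ∈ I, QuadraticFamily μ c (f i) (f₀ i)) :
    QuadraticFamily μ c (fun a s => ∑ i ∈ I, f i a s) (fun a s => ∑ i ∈ I, f₀ i a s) := by
  classical
  induction I using Finset.induction_on with
  | empty => exact ⟨fun a => by simp, 0, 0, 0, fun a => by simp⟩
  | insert i I hi ih =>
    simp only [Finset.sum_insert hi]
    exact (h i (Finset.mem_insert_self i I)).add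
      (ih fun j hj => h j (Finset.mem_insert_of_mem hj))

end QuadraticFamily

end Families

/-! ### Noise of unit conditional variance acts isometrically in `L²` on vectors known beforehand.
-/

section Noise

variable {Ω : Type*} {m m0 : MeasurableSpace Ω} {μ : Measure Ω} [IsProbabilityMeasure μ]

/-- Multiplying by a random variable of unit conditional second moment preserves square
integrability of random vectors measurable with respect to the conditioning σ-algebra. -/
theorem memLp_smul_of_condExp_sq_eq_one {F : Type*} [NormedAddCommGroup F] [NormedSpace ℝ F]
    [MeasurableSpace F] [BorelSpace F] [SecondCountableTopology F] (hm : m ≤ m0) {w : Ω → ℝ}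
    (hw : Measurable w) (hvar : μ[fun s => w s ^ 2 | m] =ᵐ[μ] 1) {y : Ω → F}
    (hy : Measurable[m] y) (hy2 : MemLp y 2 μ) : MemLp (fun s => w s • y s) 2 μ := by
  -- Otherwise the conditional expectation would be zero by convention, not one.
  have hint : Integrable (fun s => w s ^ 2) μ := by
    by_contra hn
    rw [condExp_of_not_integrable hn] at hvar
    obtain ⟨s, hs⟩ := hvar.exists
    simp at hs
  -- Weighting by `w²` does not change the measure on `m`. Comparing measures gives the isometry for
  -- lower integrals, without knowing in advance that the product is integrable.
  set ν : Measure Ω := μ.withDensity fun s => ENNReal.ofReal (w s ^ 2)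
  have hν : ν.trim hm = μ.trim hm := by
    refine @Measure.ext _ m _ _ fun A hA => ?_
    rw [trim_measurableSet_eq hm hA, trim_measurableSet_eq hm hA, withDensity_apply _ (hm A hA),
      ← ofReal_integral_eq_lintegral_ofReal hint.integrableOn (ae_of_all _ fun s => sq_nonneg _),
      ← setIntegral_condExp hm hint hA, setIntegral_congr_ae (g := 1) (hm A hA)
        (hvar.mono fun s hs _ => hs)]
    simp
  have hmeas : Measurable[m] fun s => ‖y s‖ₑ ^ 2 := (@Measurable.enorm _ _ _ _ _ _ m _ hy).pow_const 2
  have key : ∫⁻ s, ‖w s • y s‖ₑ ^ 2 ∂μ = ∫⁻ s, ‖y s‖ₑ ^ 2 ∂μ := by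
    rw [← lintegral_trim hm hmeas, ← hν, lintegral_trim hm hmeas,
      lintegral_withDensity_eq_lintegral_mul _ (by fun_prop) (hmeas.mono hm le_rfl)]
    refine lintegral_congr fun s => ?_
    rw [Pi.mul_apply, enorm_smul, mul_pow, ← Real.enorm_of_nonneg (sq_nonneg _), enorm_pow]
  have hmeas' : Measurable y := hy.mono hm le_rfl
  refine ⟨(hw.smul hmeas').aestronglyMeasurable, ?_⟩
  have h2 := hy2.2
  rw [eLpNorm_lt_top_iff_lintegral_rpow_enorm_lt_top two_ne_zero ENNReal.ofNat_ne_top] at h2 ⊢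
  simpa [key] using h2

end Noise

/-! ### The Hilbert space of controls and its dictionary with processes. -/

section Controls

variable {Ω : Type*} [m0 : MeasurableSpace Ω] {μ : Measure Ω} {m l N : ℕ}
  {ℱ : ℕ → MeasurableSpace Ω}

/-- The Hilbert space of admissible controls modulo null sets. -/
def CtrlSpace (μ : Measure Ω) (m l N : ℕ) (ℱ : ℕ → MeasurableSpace Ω) : Type _ :=
  PiLp 2 fun k : Finset.Ico l N => lpMeas (E m) ℝ (ℱ k) 2 μ

instance : NormedAddCommGroup (CtrlSpace μ m l N ℱ) :=
  inferInstanceAs (NormedAddCommGroup (PiLp 2 fun k : Finset.Ico l N =>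
    lpMeas (E m) ℝ (ℱ k) 2 μ))

instance : InnerProductSpace ℝ (CtrlSpace μ m l N ℱ) :=
  inferInstanceAs (InnerProductSpace ℝ (PiLp 2 fun k : Finset.Ico l N =>
    lpMeas (E m) ℝ (ℱ k) 2 μ))

theorem CtrlSpace.completeSpace (hℱ : ∀ k ∈ Finset.Ico l N, ℱ k ≤ m0) :
    CompleteSpace (CtrlSpace μ m l N ℱ) := by
  have : ∀ k : Finset.Ico l N, Fact (ℱ k ≤ m0) := fun k => ⟨hℱ k k.2⟩
  exact inferInstanceAs (CompleteSpace (PiLp 2 fun k : Finset.Ico l N =>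
    lpMeas (E m) ℝ (ℱ k) 2 μ))

/-- The control at a given time, as a square-integrable random vector. -/
def CtrlSpace.coord (k : Finset.Ico l N) : CtrlSpace μ m l N ℱ →L[ℝ] Lp (E m) 2 μ :=
  (lpMeas (E m) ℝ (ℱ k) 2 μ).subtypeL.comp
    (PiLp.proj 2 (𝕜 := ℝ) (fun k : Finset.Ico l N => lpMeas (E m) ℝ (ℱ k) 2 μ) k)

theorem CtrlSpace.ext {g h : CtrlSpace μ m l N ℱ} (H : ∀ k, coord k g = coord k h) : g = h :=
  PiLp.ext fun k => Subtype.ext (H k)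

theorem CtrlSpace.inner_eq_sum (g h : CtrlSpace μ m l N ℱ) :
    ⟪g, h⟫ = ∑ k, ⟪coord k g, coord k h⟫ := rfl

/-- The class of an admissible control. -/
def ctrlClass (u : {u : ℕ → Ω → E m // Admissible μ l N ℱ u}) : CtrlSpace μ m l N ℱ :=
  WithLp.toLp 2 fun k => ⟨(u.2 k k.2).2.toLp _, mem_lpMeas_iff_aestronglyMeasurable.2
    ((u.2 k k.2).1.stronglyMeasurable.aestronglyMeasurable.congr (u.2 k k.2).2.coeFn_toLp.symm)⟩

theorem ctrlClass_ae (u : {u : ℕ → Ω → E m // Admissible μ l N ℱ u}) (k : Finset.Ico l N) :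
    u.1 k =ᵐ[μ] CtrlSpace.coord k (ctrlClass u) :=
  (u.2 k k.2).2.coeFn_toLp.symm

theorem ctrlClass_eq_iff (u v : {u : ℕ → Ω → E m // Admissible μ l N ℱ u}) :
    ctrlClass u = ctrlClass v ↔ ∀ k ∈ Finset.Ico l N, u.1 k =ᵐ[μ] v.1 k := by
  constructor
  · intro h k hk
    have h1 := ctrlClass_ae u ⟨k, hk⟩
    rw [h] at h1
    exact h1.trans (ctrlClass_ae v ⟨k, hk⟩).symm
  · exact fun h => CtrlSpace.ext fun k =>
      MemLp.toLp_congr (u.2 k k.2).2 (v.2 k k.2).2 (h k k.2)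

/-- Each class has an `ℱ k`-measurable representative. This transfers minimizers and limits found in
the Hilbert space back to genuine processes. -/
theorem ctrlClass_surjective :
    Function.Surjective (ctrlClass : {u : ℕ → Ω → E m // Admissible μ l N ℱ u} → _) := by
  intro h
  have hm : ∀ k : Finset.Ico l N, ∃ f : Ω → E m, Measurable[ℱ k] f ∧
      f =ᵐ[μ] CtrlSpace.coord k h := fun k => by
    obtain ⟨f, hf, hfe⟩ := lpMeas.aestronglyMeasurable (PiLp.proj 2 (𝕜 := ℝ)
      (fun k : Finset.Ico l N => lpMeas (E m) ℝ (ℱ k) 2 μ) k h)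
    exact ⟨f, hf.measurable, hfe.symm⟩
  choose f hf hfe using hm
  obtain ⟨g, hg⟩ : ∃ g : ℕ → Ω → E m, ∀ k : Finset.Ico l N, g k = f k :=
    ⟨fun k => if hk : k ∈ Finset.Ico l N then f ⟨k, hk⟩ else 0, fun k => dif_pos k.2⟩
  have hadm : Admissible μ l N ℱ g := fun k hk => by
    rw [hg ⟨k, hk⟩]
    exact ⟨hf _, (memLp_congr_ae (hfe _)).2 (Lp.memLp _)⟩
  refine ⟨⟨g, hadm⟩, CtrlSpace.ext fun k => Lp.ext ((ctrlClass_ae ⟨g, hadm⟩ k).symm.trans ?_)⟩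
  change g k =ᵐ[μ] _
  rw [hg k]
  exact hfe k

theorem Admissible.sub {u v : ℕ → Ω → E m} (hu : Admissible μ l N ℱ u)
    (hv : Admissible μ l N ℱ v) : Admissible μ l N ℱ (u - v) := fun k hk =>
  ⟨(hu k hk).1.sub (hv k hk).1, (hu k hk).2.sub (hv k hk).2⟩

theorem ctrlClass_sub {u v : ℕ → Ω → E m} (hu : Admissible μ l N ℱ u)
    (hv : Admissible μ l N ℱ v) :
    ctrlClass ⟨u - v, hu.sub hv⟩ = ctrlClass ⟨u, hu⟩ - ctrlClass ⟨v, hv⟩ :=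
  CtrlSpace.ext fun k => by
    rw [map_sub]
    exact MemLp.toLp_sub (hu k k.2).2 (hv k k.2).2

theorem ctrlInner_eq (u v : {u : ℕ → Ω → E m // Admissible μ l N ℱ u}) :
    ctrlInner μ l N u.1 v.1 = ⟪ctrlClass u, ctrlClass v⟫ := by
  have h1 : ∀ k : Finset.Ico l N, (fun s => ⟪u.1 k s, v.1 k s⟫) =ᵐ[μ] fun s =>
      ⟪CtrlSpace.coord k (ctrlClass u) s, CtrlSpace.coord k (ctrlClass v) s⟫ := fun k => by
    filter_upwards [ctrlClass_ae u k, ctrlClass_ae v k] with s h1 h2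
    rw [h1, h2]
  rw [ctrlInner, CtrlSpace.inner_eq_sum, integral_finsetSum, ← Finset.sum_coe_sort]
  · refine Finset.sum_congr rfl fun k _ => ?_
    rw [integral_congr_ae (h1 k), ← L2.inner_def]
  · exact fun k hk => (integrable_congr (h1 ⟨k, hk⟩)).2 (L2.integrable_inner _ _)

theorem ctrlSq_eq (u : {u : ℕ → Ω → E m // Admissible μ l N ℱ u}) :
    ctrlSq μ l N u.1 = ‖ctrlClass u‖ ^ 2 := by
  rw [← real_inner_self_eq_norm_sq, ← ctrlInner_eq]
  simp only [ctrlSq, ctrlInner, real_inner_self_eq_norm_sq]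

theorem AffineFamily.ctrl {k : ℕ} (hk : k ∈ Finset.Ico l N) :
    AffineFamily μ (ctrlClass : {u : ℕ → Ω → E m // Admissible μ l N ℱ u} → _)
      (fun u => u.1 k) (fun u => u.1 k) :=
  AffineFamily.of_linear fun u => ctrlClass_ae u ⟨k, hk⟩

theorem weakLim_iff (w : ℕ → {u : ℕ → Ω → E m // Admissible μ l N ℱ u})
    (u : {u : ℕ → Ω → E m // Admissible μ l N ℱ u}) :
    WeakLim μ l N ℱ (fun j => (w j).1) u.1 ↔
      ∀ v, Tendsto (fun j => ⟪ctrlClass (w j), v⟫) atTop (𝓝 ⟪ctrlClass u, v⟫) := by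
  constructor
  · intro h v
    obtain ⟨v, rfl⟩ := ctrlClass_surjective v
    simpa only [← ctrlInner_eq] using h.2 v.1 v.2
  · refine fun h => ⟨u.2, fun v hv => ?_⟩
    simpa only [← ctrlInner_eq] using h (ctrlClass ⟨v, hv⟩)

theorem strongLim_iff (w : ℕ → {u : ℕ → Ω → E m // Admissible μ l N ℱ u})
    (u : {u : ℕ → Ω → E m // Admissible μ l N ℱ u}) :
    StrongLim μ l N ℱ (fun j => (w j).1) u.1 ↔
      Tendsto (fun j => ctrlClass (w j)) atTop (𝓝 (ctrlClass u)) := by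
  have h1 : ∀ j, ctrlSq μ l N ((w j).1 - u.1) = ‖ctrlClass (w j) - ctrlClass u‖ ^ 2 := fun j => by
    rw [← ctrlClass_sub, ← ctrlSq_eq]
  rw [tendsto_iff_norm_sub_tendsto_zero, StrongLim]
  simp only [h1, u.2, true_and]
  constructor
  · intro h
    have := h.sqrt
    simpa using this
  · intro h
    simpa using h.pow 2

theorem isOptimal_iff {Jf : (ℕ → Ω → E m) → ℝ} {J : CtrlSpace μ m l N ℱ → ℝ}
    (hJ : ∀ u : {u : ℕ → Ω → E m // Admissible μ l N ℱ u}, Jf u.1 = J (ctrlClass u))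
    (u : {u : ℕ → Ω → E m // Admissible μ l N ℱ u}) :
    IsOptimal μ l N ℱ Jf u.1 ↔ ∀ v, J (ctrlClass u) ≤ J v := by
  constructor
  · intro h v
    obtain ⟨v, rfl⟩ := ctrlClass_surjective v
    rw [← hJ, ← hJ]
    exact h.2 v.1 v.2
  · refine fun h => ⟨u.2, fun v hv => ?_⟩
    rw [hJ, hJ ⟨v, hv⟩]
    exact h _

end Controls

/-! ### Comparison of the information σ-algebras. -/

section Information

variable {Ω : Type*} {n : ℕ} {l : ℕ} {ξ : Ω → E n} {ω : ℕ → Ω → ℝ}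

theorem info_le_info {d d' k k' : ℕ} (h : ∀ i, l ≤ i → i + d ≤ k → i + d' ≤ k') :
    info l ξ ω d k ≤ info l ξ ω d' k' := by
  refine sup_le le_sup_left (iSup₂_le fun i hi => le_sup_of_le_right ?_)
  exact le_iSup₂_of_le (f := fun (i : ℕ) (_ : l ≤ i ∧ i + d' ≤ k') =>
    MeasurableSpace.comap (ω i) inferInstance) i ⟨hi.1, h i hi.1 hi.2⟩ le_rfl

theorem info_le [m0 : MeasurableSpace Ω] (hξ : Measurable ξ) {d k : ℕ}
    (hω : ∀ i, l ≤ i → i + d ≤ k → Measurable (ω i)) : info l ξ ω d k ≤ m0 :=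
  sup_le hξ.comap_le (iSup_le fun i => iSup_le fun hi => (hω i hi.1 hi.2).comap_le)

theorem measurable_noise_info {d k i : ℕ} (hl : l ≤ i) (hi : i + d ≤ k) :
    Measurable[info l ξ ω d k] (ω i) := by
  refine Measurable.mono (comap_measurable (ω i)) ?_ le_rfl
  exact le_sup_of_le_right (le_iSup₂_of_le i ⟨hl, hi⟩ le_rfl)

end Information

/-! ### The state recursion and its measurability. -/

section StateSpace

variable {Ω : Type*} {n m : ℕ}

/-- A matrix as a bounded linear map between Euclidean spaces. -/
def actL {p r : ℕ} (M : Matrix (Fin p) (Fin r) ℝ) : E r →L[ℝ] E p :=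
  LinearMap.toContinuousLinearMap
    { toFun := act M
      map_add' := fun x y => by simp [act, Matrix.mulVec_add]
      map_smul' := fun c x => by simp [act, Matrix.mulVec_smul] }

theorem measurable_act {p r : ℕ} (M : Matrix (Fin p) (Fin r) ℝ) [MeasurableSpace Ω]
    {x : Ω → E r} (hx : Measurable x) : Measurable fun s => act M (x s) :=
  (actL M).continuous.measurable.comp hx

theorem AffineFamily.act [MeasurableSpace Ω] {μ : Measure Ω} {H α : Type*}
    [NormedAddCommGroup H] [InnerProductSpace ℝ H] {c : α → H} {p r : ℕ} {x x₀ : α → Ω → E r}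
    (hx : AffineFamily μ c x x₀) (M : Matrix (Fin p) (Fin r) ℝ) :
    AffineFamily μ c (fun a s => MFLQ.act M (x a s)) (fun a s => MFLQ.act M (x₀ a s)) :=
  hx.clm (actL M)

theorem measurable_affine {p q r : ℕ} [MeasurableSpace Ω] (M : Matrix (Fin p) (Fin q) ℝ)
    (M' : Matrix (Fin p) (Fin r) ℝ) (v v' b : E p) {x : Ω → E q} {u : Ω → E r}
    (hx : Measurable x) (hu : Measurable u) :
    Measurable fun s => MFLQ.act M (x s) + v + MFLQ.act M' (u s) + v' + b :=
  ((((measurable_act M hx).add_const v).add (measurable_act M' hu)).add_const v').add_const b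

variable [m0 : MeasurableSpace Ω] {μ : Measure Ω} {P : Coeff Ω n m} {ω : ℕ → Ω → ℝ} {l N : ℕ}
  {x0 ξ : Ω → E n} {d : ℕ}

theorem state_start (P : Coeff Ω n m) (μ : Measure Ω) (ω : ℕ → Ω → ℝ) (l : ℕ) (x0 : Ω → E n)
    (u : ℕ → Ω → E m) : state P μ ω l x0 u l = x0 := by
  cases l <;> simp [state]

theorem state_succ (P : Coeff Ω n m) (μ : Measure Ω) (ω : ℕ → Ω → ℝ) {l k : ℕ} (hk : l ≤ k)
    (x0 : Ω → E n) (u : ℕ → Ω → E m) : state P μ ω l x0 u (k + 1) = fun s =>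
      MFLQ.act (P.A k) (state P μ ω l x0 u k s)
        + MFLQ.act (P.Abar k) (∫ t, state P μ ω l x0 u k t ∂μ)
        + MFLQ.act (P.B k) (u k s) + MFLQ.act (P.Bbar k) (∫ t, u k t ∂μ) + P.b k
        + ω k s • (MFLQ.act (P.C k) (state P μ ω l x0 u k s)
            + MFLQ.act (P.Cbar k) (∫ t, state P μ ω l x0 u k t ∂μ)
            + MFLQ.act (P.D k) (u k s) + MFLQ.act (P.Dbar k) (∫ t, u k t ∂μ) + P.sig k) := by
  rw [state, if_neg hk.not_gt]

/-- The state at time `k` is measurable with respect to the information before the noise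
`ω k`. -/
theorem measurable_state (hd : d ≤ 1) (hx0 : Measurable[MeasurableSpace.comap ξ inferInstance] x0)
    {u : ℕ → Ω → E m} (hu : Admissible μ l N (info l ξ ω d) u) {k : ℕ} (hlk : l ≤ k)
    (hkN : k ≤ N) : Measurable[info l ξ ω 1 k] (state P μ ω l x0 u k) := by
  induction k, hlk using Nat.le_induction with
  | base =>
    rw [state_start]
    exact hx0.mono le_sup_left le_rfl
  | succ k hlk ih =>
    have hx : Measurable[info l ξ ω 1 (k + 1)] (state P μ ω l x0 u k) :=
      (ih (by omega)).mono (info_le_info fun i _ _ => by omega) le_rfl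
    -- At lag zero `u k` may depend on `ω k`, which is already contained in the information `info l
    -- ξ ω 1 (k + 1)`.
    have huk : Measurable[info l ξ ω 1 (k + 1)] (u k) :=
      (hu k (Finset.mem_Ico.2 ⟨hlk, by omega⟩)).1.mono
        (info_le_info fun i _ _ => by omega) le_rfl
    have hω : Measurable[info l ξ ω 1 (k + 1)] (ω k) := measurable_noise_info hlk le_rfl
    rw [state_succ P μ ω hlk]
    exact Measurable.add (@measurable_affine Ω _ _ _ (info l ξ ω 1 (k + 1)) _ _ _ _ _ _ _ hx huk)
      (Measurable.smul hω (@measurable_affine Ω _ _ _ (info l ξ ω 1 (k + 1)) _ _ _ _ _ _ _ hx huk))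

end StateSpace

/-! ### The cost as a quadratic functional of the control. -/

section CostFunctional

variable {Ω : Type*} [m0 : MeasurableSpace Ω] {μ : Measure Ω} [IsProbabilityMeasure μ]
  {n m : ℕ} {P : Coeff Ω n m} {ω : ℕ → Ω → ℝ} {l N : ℕ} {x0 ξ : Ω → E n} {d : ℕ}

omit [IsProbabilityMeasure μ] in
theorem IsNoise.info_le (hω : IsNoise μ l N ξ ω) (hξ : Measurable ξ) {k : ℕ} (hk : k < N) :
    info l ξ ω d k ≤ m0 :=
  MFLQ.info_le hξ fun i hi hik => hω.meas i (Finset.mem_Ico.2 ⟨hi, by omega⟩)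

theorem IsNoise.memLp_smul (hω : IsNoise μ l N ξ ω) (hξ : Measurable ξ) {k : ℕ}
    (hk : k ∈ Finset.Ico l N) {p : ℕ} {y : Ω → E p} (hy : Measurable[info l ξ ω 1 k] y)
    (hy2 : MemLp y 2 μ) : MemLp (fun s => ω k s • y s) 2 μ :=
  memLp_smul_of_condExp_sq_eq_one (hω.info_le hξ (Finset.mem_Ico.1 hk).2) (hω.meas k hk)
    (hω.var k hk) hy hy2

/-- At lag one the control precedes `ω k`, so the isometry applies; at lag zero this is the
well-posedness assumption. -/
theorem IsNoise.memLp_control (hω : IsNoise μ l N ξ ω) (hξ : Measurable ξ) (hd : d ≤ 1)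
    (hwell : d = 0 → ∀ u : ℕ → Ω → E m, Admissible μ l N (info l ξ ω d) u →
      ∀ k ∈ Finset.Ico l N, MemLp (fun s => ω k s • MFLQ.act (P.D k) (u k s)) 2 μ)
    {u : ℕ → Ω → E m} (hu : Admissible μ l N (info l ξ ω d) u) {k : ℕ}
    (hk : k ∈ Finset.Ico l N) : MemLp (fun s => ω k s • MFLQ.act (P.D k) (u k s)) 2 μ := by
  obtain rfl | rfl : d = 0 ∨ d = 1 := by omega
  · exact hwell rfl u hu k hk
  · refine hω.memLp_smul hξ hk ?_ ((actL (P.D k)).comp_memLp' (hu k hk).2)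
    exact @measurable_act Ω _ _ (P.D k) (info l ξ ω 1 k) _ (hu k hk).1

/-- The control term is split off because at lag zero it need not be measurable before `ω k`,
whereas the remaining terms are. -/
theorem IsNoise.memLp_diffusion (hω : IsNoise μ l N ξ ω) (hξ : Measurable ξ) {k p q r : ℕ}
    (hk : k ∈ Finset.Ico l N) (M : Matrix (Fin p) (Fin q) ℝ) (M' : Matrix (Fin p) (Fin r) ℝ)
    (v v' b : E p) {x : Ω → E q} {u : Ω → E r} (hx : Measurable[info l ξ ω 1 k] x)
    (hx2 : MemLp x 2 μ) (hu : MemLp (fun s => ω k s • MFLQ.act M' (u s)) 2 μ) :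
    MemLp (fun s => ω k s • (MFLQ.act M (x s) + v + MFLQ.act M' (u s) + v' + b)) 2 μ := by
  have h1 : MemLp (fun s => ω k s • (MFLQ.act M (x s) + (v + v' + b))) 2 μ := by
    refine hω.memLp_smul hξ hk ?_ (((actL M).comp_memLp' hx2).add (memLp_const _))
    exact ((actL M).continuous.add continuous_const).measurable.comp hx
  convert h1.add hu using 1
  funext s
  rw [Pi.add_apply, ← smul_add]
  congr 1
  abel

/-- The state is an affine function of the control, whose linear part is the state of the
homogeneous problem started from zero. -/
theorem state_affineFamily (hω : IsNoise μ l N ξ ω) (hξ : Measurable ξ) (hξ2 : MemLp ξ 2 μ)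
    (hd : d ≤ 1)
    (hwell : d = 0 → ∀ u : ℕ → Ω → E m, Admissible μ l N (info l ξ ω d) u →
      ∀ k ∈ Finset.Ico l N, MemLp (fun s => ω k s • MFLQ.act (P.D k) (u k s)) 2 μ)
    {k : ℕ} (hlk : l ≤ k) (hkN : k ≤ N) :
    AffineFamily μ
      (ctrlClass : {u : ℕ → Ω → E m // Admissible μ l N (info l ξ ω d) u} → _)
      (fun u => state P μ ω l ξ u.1 k) (fun u => state P.homogeneous μ ω l 0 u.1 k) := by
  have : CompleteSpace (CtrlSpace μ m l N (info l ξ ω d)) :=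
    CtrlSpace.completeSpace fun k hk => hω.info_le hξ (Finset.mem_Ico.1 hk).2
  induction k, hlk using Nat.le_induction with
  | base =>
    simp only [state_start]
    exact AffineFamily.const hξ2
  | succ k hlk ih =>
    have hk : k ∈ Finset.Ico l N := Finset.mem_Ico.2 ⟨hlk, by omega⟩
    have X := ih (by omega)
    have U := AffineFamily.ctrl (μ := μ) (m := m) (ℱ := info l ξ ω d) hk
    simp only [state_succ _ _ _ hlk]
    refine AffineFamily.add
      (((((X.act (P.A k)).add (X.expect.act (P.Abar k))).add (U.act (P.B k))).add
        (U.expect.act (P.Bbar k))).add (AffineFamily.const (memLp_const (P.b k))))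
      (AffineFamily.smul_of_memLp
        (((((X.act (P.C k)).add (X.expect.act (P.Cbar k))).add (U.act (P.D k))).add
          (U.expect.act (P.Dbar k))).add (AffineFamily.const (memLp_const (P.sig k))))
        ctrlClass_surjective (ω k) (fun u => ?_) (fun u => ?_))
    · exact hω.memLp_diffusion hξ hk _ _ _ _ _
        (measurable_state hd (comap_measurable ξ) u.2 hlk (by omega)) (X.memLp u)
        (hω.memLp_control hξ hd hwell u.2 hk)
    · exact hω.memLp_diffusion hξ hk _ _ _ _ _
        (measurable_state hd (measurable_const (a := 0)) u.2 hlk (by omega)) (X.memLp_linear u)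
        (hω.memLp_control hξ hd hwell u.2 hk)

/-- The cost is a continuous quadratic function of the control, whose purely quadratic part is
the cost of the homogeneous problem started from zero. -/
theorem cost_quadratic (hP : P.Regular μ l N) (hlN : l ≤ N) (hω : IsNoise μ l N ξ ω)
    (hξ : Measurable ξ) (hξ2 : MemLp ξ 2 μ) (hd : d ≤ 1)
    (hwell : d = 0 → ∀ u : ℕ → Ω → E m, Admissible μ l N (info l ξ ω d) u →
      ∀ k ∈ Finset.Ico l N, MemLp (fun s => ω k s • MFLQ.act (P.D k) (u k s)) 2 μ) :
    ∃ (B : CtrlSpace μ m l N (info l ξ ω d) →L[ℝ] CtrlSpace μ m l N (info l ξ ω d) →L[ℝ] ℝ)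
      (L : CtrlSpace μ m l N (info l ξ ω d) →L[ℝ] ℝ) (r : ℝ),
      ∀ u : {u : ℕ → Ω → E m // Admissible μ l N (info l ξ ω d) u},
        cost P μ ω l N ξ u.1 = B (ctrlClass u) (ctrlClass u) + L (ctrlClass u) + r ∧
        cost P.homogeneous μ ω l N 0 u.1 = B (ctrlClass u) (ctrlClass u) := by
  have X := fun (k : ℕ) (hlk : l ≤ k) (hkN : k ≤ N) =>
    state_affineFamily (P := P) hω hξ hξ2 hd hwell hlk hkN
  have XN := X N hlN le_rfl
  have hrun := QuadraticFamily.sum (I := Finset.Ico l N) fun k hk =>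
    have Xk := X k (Finset.mem_Ico.1 hk).1 (Finset.mem_Ico.1 hk).2.le
    have Uk := AffineFamily.ctrl (μ := μ) (m := m) (ℱ := info l ξ ω d) hk
    ((((Xk.act (P.Q k)).inner Xk).add (((Xk.act (P.S k)).inner Uk).const_mul 2)).add
      ((Uk.act (P.R k)).inner Uk)).add
      ((((AffineFamily.const (hP.q_mem k hk)).inner Xk).add
        ((AffineFamily.const (hP.rho_mem k hk)).inner Uk)).const_mul 2)
  have hmean := QuadraticFamily.sum (I := Finset.Ico l N) fun k hk =>
    have Xk := X k (Finset.mem_Ico.1 hk).1 (Finset.mem_Ico.1 hk).2.le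
    have Uk := AffineFamily.ctrl (μ := μ) (m := m) (ℱ := info l ξ ω d) hk
    ((((Xk.expect.act (P.Qbar k)).inner Xk.expect).add
      (((Xk.expect.act (P.Sbar k)).inner Uk.expect).const_mul 2)).add
      ((Uk.expect.act (P.Rbar k)).inner Uk.expect)).add
      (((Xk.inner_expect (hP.qbar_int k hk)).add
        (Uk.inner_expect (hP.rhobar_int k hk))).const_mul 2)
  obtain ⟨-, B, L, r, h⟩ := (((((XN.act P.G).inner XN).add
    (((AffineFamily.const hP.g_mem).inner XN).const_mul 2)).add
    ((XN.expect.act P.Gbar).inner XN.expect)).add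
    ((XN.inner_expect hP.gbar_int).const_mul 2)).add hrun |>.add hmean
  -- The families were assembled in the nesting order of `cost`, with zero functions for the
  -- homogeneous weights, so both identities match definitionally.
  exact ⟨B, L, r, h⟩

end CostFunctional

end MFLQ

end

/-! ### The main theorem: transfer of the Hilbert space results to controls. -/

open MFLQ

theorem theorem6p3 {Ω : Type*} [MeasurableSpace Ω] (μ : Measure Ω) [IsProbabilityMeasure μ]
    {n m : ℕ} (l N : ℕ) (hlN : l < N) (P : MFLQ.Coeff Ω n m) (hP : P.Regular μ l N)
    (ξ : Ω → MFLQ.E n) (hξ : Measurable ξ) (hξ2 : MemLp ξ 2 μ)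
    (ω : ℕ → Ω → ℝ) (hω : MFLQ.IsNoise μ l N ξ ω)
    -- information lag of the controls: `u_k` is `𝔉_{k-d}`-measurable
    (d : ℕ) (hd : d ≤ 1)
    -- for lag zero, the state has to be square integrable for the cost to be defined
    (hwell : d = 0 → ∀ u : ℕ → Ω → MFLQ.E m, MFLQ.Admissible μ l N (MFLQ.info l ξ ω d) u →
      ∀ k ∈ Finset.Ico l N, MemLp (fun s => ω k s • MFLQ.act (P.D k) (u k s)) 2 μ)
    -- assumption (A1)
    (hA1 : ∀ u : ℕ → Ω → MFLQ.E m, MFLQ.Admissible μ l N (MFLQ.info l ξ ω d) u →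
      0 ≤ MFLQ.cost P.homogeneous μ ω l N 0 u) :
    -- every regularized problem has an optimal control, unique up to null sets
    (∀ ε : ℝ, 0 < ε → ∃ u : ℕ → Ω → MFLQ.E m,
      MFLQ.IsOptimal μ l N (MFLQ.info l ξ ω d) (MFLQ.regCost P μ ω l N ξ ε) u ∧
      ∀ v, MFLQ.IsOptimal μ l N (MFLQ.info l ξ ω d) (MFLQ.regCost P μ ω l N ξ ε) v →
        ∀ k ∈ Finset.Ico l N, v k =ᵐ[μ] u k) ∧
    ∀ uε : ℝ → ℕ → Ω → MFLQ.E m,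
      (∀ ε : ℝ, 0 < ε →
        MFLQ.IsOptimal μ l N (MFLQ.info l ξ ω d) (MFLQ.regCost P μ ω l N ξ ε) (uε ε)) →
      List.TFAE [
        ∃ u, MFLQ.IsOptimal μ l N (MFLQ.info l ξ ω d) (MFLQ.cost P μ ω l N ξ) u,
        ∃ e : ℕ → ℝ, MFLQ.IsVanishing e ∧
          ∃ u, MFLQ.WeakLim μ l N (MFLQ.info l ξ ω d) (fun j => uε (e j)) u,
        ∃ e : ℕ → ℝ, MFLQ.IsVanishing e ∧
          ∃ u, MFLQ.StrongLim μ l N (MFLQ.info l ξ ω d) (fun j => uε (e j)) u] ∧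
      (∀ e : ℕ → ℝ, MFLQ.IsVanishing e → ∀ u : ℕ → Ω → MFLQ.E m,
        MFLQ.WeakLim μ l N (MFLQ.info l ξ ω d) (fun j => uε (e j)) u ∨
          MFLQ.StrongLim μ l N (MFLQ.info l ξ ω d) (fun j => uε (e j)) u →
        MFLQ.IsOptimal μ l N (MFLQ.info l ξ ω d) (MFLQ.cost P μ ω l N ξ) u) := by

  have hℱ : ∀ k ∈ Finset.Ico l N, info l ξ ω d k ≤ ‹MeasurableSpace Ω› := fun k hk =>
    hω.info_le hξ (Finset.mem_Ico.1 hk).2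
  have := CtrlSpace.completeSpace (μ := μ) (m := m) hℱ
  obtain ⟨B, L, r, hcost⟩ := cost_quadratic hP hlN.le hω hξ hξ2 hd hwell
  set J : CtrlSpace μ m l N (info l ξ ω d) → ℝ := fun h => B h h + L h + r
  have hJ : ∀ h, J h = B h h + L h + r := fun _ => rfl
  have hB : ∀ h, 0 ≤ B h h := fun h => by
    obtain ⟨u, rfl⟩ := ctrlClass_surjective h
    rw [← (hcost u).2]
    exact hA1 u.1 u.2
  have hopt := isOptimal_iff (J := J) fun u => (hcost u).1
  have hreg := fun ε : ℝ => isOptimal_iff (Jf := regCost P μ ω l N ξ ε) (J := tikhonov J ε)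
    fun u => by simp only [regCost, tikhonov, J, (hcost u).1, ctrlSq_eq]
  refine ⟨fun ε hε => ?_, fun uε huε => ?_⟩
  · obtain ⟨h, hh⟩ := exists_tikhonov_minimizer hJ hB hε
    obtain ⟨u, rfl⟩ := ctrlClass_surjective h
    refine ⟨u.1, (hreg ε u).2 hh, fun v hv => ?_⟩
    exact (ctrlClass_eq_iff ⟨v, hv.1⟩ u).1
      (tikhonov_minimizer_unique hJ hB hε hh ((hreg ε ⟨v, hv.1⟩).1 hv))
  have hw : ∀ e : ℕ → ℝ, IsVanishing e → ∃ w : ℕ → {u // Admissible μ l N (info l ξ ω d) u},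
      (fun j => uε (e j)) = (fun j => (w j).1) ∧
        ∀ j v, tikhonov J (e j) (ctrlClass (w j)) ≤ tikhonov J (e j) v := fun e he =>
    ⟨fun j => ⟨uε (e j), (huε _ (he.2.1 j)).1⟩, rfl, fun j =>
      (hreg (e j) ⟨uε (e j), (huε _ (he.2.1 j)).1⟩).1 (huε _ (he.2.1 j))⟩
  have hweak : ∀ e : ℕ → ℝ, IsVanishing e → ∀ u,
      WeakLim μ l N (info l ξ ω d) (fun j => uε (e j)) u →
        IsOptimal μ l N (info l ξ ω d) (cost P μ ω l N ξ) u := fun e he u hu => by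
    obtain ⟨w, hwe, hw⟩ := hw e he
    rw [hwe] at hu
    exact (hopt ⟨u, hu.1⟩).2
      (minimizer_of_tikhonov_weak_limit hJ hB he hw ((weakLim_iff w ⟨u, hu.1⟩).1 hu))
  have hstrong : ∀ e : ℕ → ℝ, IsVanishing e → ∀ u,
      StrongLim μ l N (info l ξ ω d) (fun j => uε (e j)) u →
        WeakLim μ l N (info l ξ ω d) (fun j => uε (e j)) u := fun e he u hu => by
    obtain ⟨w, hwe, -⟩ := hw e he
    rw [hwe] at hu ⊢
    exact (weakLim_iff w ⟨u, hu.1⟩).2 fun v =>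
      ((strongLim_iff w ⟨u, hu.1⟩).1 hu).inner tendsto_const_nhds
  refine ⟨?_, fun e he u hu => hweak e he u (hu.elim id (hstrong e he u))⟩
  tfae_have 1 → 3 := by
    rintro ⟨us, hus⟩
    -- Any vanishing sequence would serve here, since solvability forces strong convergence along
    -- all of them.
    have he : IsVanishing fun j : ℕ => 1 / ((j : ℝ) + 1) := by
      refine ⟨fun i j hij => ?_, fun j => by positivity, tendsto_one_div_add_atTop_nhds_zero_nat⟩
      have : (i : ℝ) < j := by exact_mod_cast hij
      exact one_div_lt_one_div_of_lt (by positivity) (by linarith)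
    obtain ⟨w, hwe, hw⟩ := hw _ he
    obtain ⟨h, hh⟩ := tikhonov_converges hJ hB he hw ((hopt ⟨us, hus.1⟩).1 hus)
    obtain ⟨u, rfl⟩ := ctrlClass_surjective h
    refine ⟨_, he, u.1, ?_⟩
    rw [hwe]
    exact (strongLim_iff w u).2 hh
  tfae_have 3 → 2 := fun ⟨e, he, u, hu⟩ => ⟨e, he, u, hstrong e he u hu⟩
  tfae_have 2 → 1 := fun ⟨e, he, u, hu⟩ => ⟨u, hweak e he u hu⟩
  tfae_finish
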